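/- **Strong completeness for $\mathbf{PD}^{\vee}$.** Formulas of $\mathbf{PD}^{\vee}$ (propositional dependence logic with intuitionistic disjunction) are given by $$\phi ::= p_i \mid \neg p_i \mid \bot \mid (\phi\wedge\phi)\mid(\phi\otimes\phi)\mid(\phi\vee\phi)\qquad(i\in\mathbb N);$$ a formula is *classical* if $\vee$ does not occur in it. A *team* is a set $X\subseteq\{0,1\}^{\mathbb N}$ of valuations, and truth on a team is defined by: $X\models p_i$ iff $s(i)=1$ for all $s\in X$; $X\models\neg p_i$ iff $s(i)=0$ for all $s\in X$; $X\models\bot$ iff $X=\emptyset$; $X\models\phi\wedge\psi$ iff $X\models\phi$ and $X\models\psi$; $X\models\phi\otimes\psi$ iff $X=Y\cup Z$ for some $Y,Z\subseteq X$ with $Y\models\phi$ and $Z\models\psi$; $X\models\phi\vee\psi$ iff $X\models\phi$ or $X\models\psi$. For a set $\Gamma$ of formulas, $\Gamma\models\phi$ means that every team $X$ with $X\models\gamma$ for all $\gamma\in\Gamma$ satisfies $X\models\phi$. $\Gamma\vdash\phi$ means that $\phi$ has a derivation with all undischarged hypotheses in $\Gamma$ in the natural deduction system with the axioms $p_i\otimes\neg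 p_i$ ($i\in\mathbb N$) and the following rules, where $\phi,\psi,\chi$ are arbitrary formulas, $\alpha$ is a classical formula, $i\in\mathbb N$, and $[\cdot]$ marks a hypothesis that the rule discharges (subderivations may use further hypotheses): - $\wedge$: from $\phi$ and $\psi$ infer $\phi\wedge\psi$; from $\phi\wedge\psi$ infer $\phi$; from $\phi\wedge\psi$ infer $\psi$. - $\vee$: from $\phi$ infer $\phi\vee\psi$; from $\psi$ infer $\phi\vee\psi$; from $\phi\vee\psi$, a derivation of $\chi$ from $[\phi]$ and a derivation of $\chi$ from $[\psi]$, infer $\chi$. - $\otimes$: from $\phi$ infer $\phi\otimes\psi$; from $\psi$ infer $\phi\otimes\psi$; from $\phi\otimes\psi$, a derivation of $\alpha$ from $[\phi]$ and a derivation of $\alpha$ from $[\psi]$, infer $\alpha$ (only for classical $\alpha$); from $\phi\otimes\psi$ and a derivation of $\chi$ from $[\psi]$, infer $\phi\otimes\chi$; from $\phi\otimes\psi$ infer $\psi\otimes\phi$; from $\phi\otimes(\psi\otimes\chi)$ infer $(\phi\otimes\psi)\otimes\chi$. - $\bot$: from $p_i\wedge\neg p_i$ infer $\bot$; from $\phi\otimes\bot$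 infer $\phi$. - Distributivity: from $\phi\otimes(\psi\vee\chi)$ infer $(\phi\otimes\psi)\vee(\phi\otimes\chi)$. **Theorem.** For every set $\Gamma$ of formulas of $\mathbf{PD}^{\vee}$ and every formula $\phi$ of $\mathbf{PD}^{\vee}$: if $\Gamma\models\phi$, then $\Gamma\vdash\phi$. -/

import Mathlib

namespace PDVee

/-- Formulas of propositional dependence logic with intuitionistic disjunction. The propositional
variables are indexed by the natural numbers, and negation is applied to variables only. -/
inductive Formula : Type where
  | var (i : ℕ) : Formula
  | negVar (i : ℕ) : Formula
  | bot : Formula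
  | and (φ ψ : Formula) : Formula
  | tensor (φ ψ : Formula) : Formula
  | vee (φ ψ : Formula) : Formula

/-- A formula is classical if the intuitionistic disjunction does not occur in it. -/
def Formula.IsClassical : Formula → Prop
  | .var _ => True
  | .negVar _ => True
  | .bot => True
  | .and φ ψ => φ.IsClassical ∧ ψ.IsClassical
  | .tensor φ ψ => φ.IsClassical ∧ ψ.IsClassical
  | .vee _ _ => False

/-- A valuation assigns a truth value to every propositional variable. -/
abbrev Valuation : Type := ℕ → Bool

/-- A team is an arbitrary set of valuations. -/
abbrev Team : Type := Set Valuation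

/-- Team semantics: truth of a formula on a team. -/
def Sat : Team → Formula → Prop
  | X, .var i => ∀ s ∈ X, s i = true
  | X, .negVar i => ∀ s ∈ X, s i = false
  | X, .bot => X = ∅
  | X, .and φ ψ => Sat X φ ∧ Sat X ψ
  | X, .tensor φ ψ => ∃ Y Z : Team, Y ⊆ X ∧ Z ⊆ X ∧ X = Y ∪ Z ∧ Sat Y φ ∧ Sat Z ψ
  | X, .vee φ ψ => Sat X φ ∨ Sat X ψ

/-- Semantic consequence: every team on which all formulas of `Γ` are true makes `φ` true. -/
def Entails (Γ : Set Formula) (φ : Formula) : Prop :=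
  ∀ X : Team, (∀ γ ∈ Γ, Sat X γ) → Sat X φ

/-- The natural deduction system: `Derives Γ φ` says that there is a (finite) derivation of `φ`
all of whose undischarged hypotheses belong to `Γ`. A rule that discharges the hypothesis `φ` in
a subderivation has a premise whose set of available hypotheses is `insert φ Γ`. -/
inductive Derives : Set Formula → Formula → Prop where
  | hyp {Γ : Set Formula} {φ : Formula} (h : φ ∈ Γ) : Derives Γ φ
  /-- Atomic excluded middle. -/
  | em (Γ : Set Formula) (i : ℕ) : Derives Γ (.tensor (.var i) (.negVar i))
  | andI {Γ : Set Formula} {φ ψ : Formula} :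
      Derives Γ φ → Derives Γ ψ → Derives Γ (.and φ ψ)
  | andE₁ {Γ : Set Formula} {φ ψ : Formula} : Derives Γ (.and φ ψ) → Derives Γ φ
  | andE₂ {Γ : Set Formula} {φ ψ : Formula} : Derives Γ (.and φ ψ) → Derives Γ ψ
  | veeI₁ {Γ : Set Formula} {φ ψ : Formula} : Derives Γ φ → Derives Γ (.vee φ ψ)
  | veeI₂ {Γ : Set Formula} {φ ψ : Formula} : Derives Γ ψ → Derives Γ (.vee φ ψ)
  | veeE {Γ : Set Formula} {φ ψ χ : Formula} :
      Derives Γ (.vee φ ψ) → Derives (insert φ Γ) χ → Derives (insert ψ Γ) χ → Derives Γ χ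
  | tensorI₁ {Γ : Set Formula} {φ ψ : Formula} : Derives Γ φ → Derives Γ (.tensor φ ψ)
  | tensorI₂ {Γ : Set Formula} {φ ψ : Formula} : Derives Γ ψ → Derives Γ (.tensor φ ψ)
  /-- Weak elimination: the conclusion has to be classical. -/
  | tensorE {Γ : Set Formula} {φ ψ α : Formula} (hα : α.IsClassical) :
      Derives Γ (.tensor φ ψ) → Derives (insert φ Γ) α → Derives (insert ψ Γ) α → Derives Γ α
  /-- Tensor disjunction substitution. -/
  | tensorSub {Γ : Set Formula} {φ ψ χ : Formula} :
      Derives Γ (.tensor φ ψ) → Derives (insert ψ Γ) χ → Derives Γ (.tensor φ χ)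
  | tensorComm {Γ : Set Formula} {φ ψ : Formula} :
      Derives Γ (.tensor φ ψ) → Derives Γ (.tensor ψ φ)
  | tensorAssoc {Γ : Set Formula} {φ ψ χ : Formula} :
      Derives Γ (.tensor φ (.tensor ψ χ)) → Derives Γ (.tensor (.tensor φ ψ) χ)
  | botI {Γ : Set Formula} {i : ℕ} : Derives Γ (.and (.var i) (.negVar i)) → Derives Γ .bot
  | botE {Γ : Set Formula} {φ : Formula} : Derives Γ (.tensor φ .bot) → Derives Γ φ
  /-- Distributivity of tensor over intuitionistic disjunction. -/
  | distr {Γ : Set Formula} {φ ψ χ : Formula} :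
      Derives Γ (.tensor φ (.vee ψ χ)) → Derives Γ (.vee (.tensor φ ψ) (.tensor φ χ))

end PDVee

namespace PDVee

/-! ### Team semantics -/

/-! Argue by contraposition: if `Γ` does not derive `φ`, enlarge it to a maximal `Δ` not deriving
`φ`. Such a `Δ` is deductively closed and prime for `∨`. One team then refutes the entailment,
namely all valuations satisfying the classical members of `Δ`: exactly the members of `Δ` are true
on it (`sat_canonicalTeam_iff`).

By distributivity every formula is interderivable with a `∨` of classical formulas
(`Formula.exists_isNormal`), so primeness reduces this truth lemma to classical formulas. These are
flat, hence truth on the team is ordinary consequence from the classical part of `Δ`, and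
`derives_of_isClassical` turns that into derivability.

That last lemma uses a second maximal extension, this time avoiding a classical `α`. Weak
`⊗`-elimination then applies with conclusion `α` and makes the extension prime for `⊗` as well, so
that it describes a single valuation. The first `Δ` need not have this property. -/

theorem Sat.mono {φ : Formula} {X Y : Team} (h : Sat X φ) (hYX : Y ⊆ X) : Sat Y φ := by
  induction φ generalizing X Y with
  | var i => exact fun s hs => h s (hYX hs)
  | negVar i => exact fun s hs => h s (hYX hs)
  | bot =>
    have hX : X = ∅ := h
    exact Set.subset_eq_empty hYX hX
  | and φ ψ ihφ ihψ => exact ⟨ihφ h.1 hYX, ihψ h.2 hYX⟩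
  | tensor φ ψ ihφ ihψ =>
    obtain ⟨U, V, -, -, rfl, hU, hV⟩ := h
    refine ⟨U ∩ Y, V ∩ Y, Set.inter_subset_right, Set.inter_subset_right, ?_,
      ihφ hU Set.inter_subset_left, ihψ hV Set.inter_subset_left⟩
    rw [← Set.union_inter_distrib_right, Set.inter_eq_right.2 hYX]
  | vee φ ψ ihφ ihψ => exact h.imp (fun h => ihφ h hYX) (fun h => ihψ h hYX)

/-- Every formula is true on the empty team. -/
theorem sat_empty (φ : Formula) : Sat ∅ φ := by
  induction φ with
  | var i => exact fun s hs => hs.elim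
  | negVar i => exact fun s hs => hs.elim
  | bot => rfl
  | and φ ψ ihφ ihψ => exact ⟨ihφ, ihψ⟩
  | tensor φ ψ ihφ ihψ =>
    exact ⟨∅, ∅, subset_rfl, subset_rfl, (Set.union_empty ∅).symm, ihφ, ihψ⟩
  | vee φ ψ ihφ ihψ => exact Or.inl ihφ

theorem sat_singleton_tensor {s : Valuation} {φ ψ : Formula} :
    Sat {s} (.tensor φ ψ) ↔ Sat {s} φ ∨ Sat {s} ψ := by
  constructor
  · rintro ⟨U, V, -, -, hUV, hU, hV⟩
    have hs : s ∈ U ∪ V := hUV ▸ Set.mem_singleton s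
    exact hs.imp (fun h => hU.mono (Set.singleton_subset_iff.2 h))
      (fun h => hV.mono (Set.singleton_subset_iff.2 h))
  · rintro (h | h)
    · exact ⟨{s}, ∅, subset_rfl, Set.empty_subset _, (Set.union_empty _).symm, h, sat_empty ψ⟩
    · exact ⟨∅, {s}, Set.empty_subset _, subset_rfl, (Set.empty_union _).symm, sat_empty φ, h⟩

/-- Classical formulas are flat. -/
theorem Formula.IsClassical.sat_iff {α : Formula} (hα : α.IsClassical) {X : Team} :
    Sat X α ↔ ∀ s ∈ X, Sat {s} α := by
  refine ⟨fun h s hs => h.mono (Set.singleton_subset_iff.2 hs), fun h => ?_⟩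
  induction α generalizing X with
  | var i => exact fun s hs => h s hs s rfl
  | negVar i => exact fun s hs => h s hs s rfl
  | bot => exact Set.eq_empty_of_forall_notMem fun s hs => Set.singleton_ne_empty s (h s hs)
  | and φ ψ ihφ ihψ =>
    exact ⟨ihφ hα.1 fun s hs => (h s hs).1, ihψ hα.2 fun s hs => (h s hs).2⟩
  | tensor φ ψ ihφ ihψ =>
    refine ⟨{s ∈ X | Sat {s} φ}, {s ∈ X | Sat {s} ψ}, Set.sep_subset _ _, Set.sep_subset _ _, ?_,
      ihφ hα.1 fun s hs => hs.2, ihψ hα.2 fun s hs => hs.2⟩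
    ext s
    refine ⟨fun hs => ?_, fun hs => hs.elim And.left And.left⟩
    exact (sat_singleton_tensor.1 (h s hs)).imp (fun h => ⟨hs, h⟩) (fun h => ⟨hs, h⟩)
  | vee φ ψ => exact hα.elim

/-- Needed for completeness itself: interderivable formulas must be true on the same teams when a
formula is replaced by its normal form (`Le.sat`). -/
theorem Derives.sound {Γ : Set Formula} {φ : Formula} (h : Derives Γ φ) : Entails Γ φ := by
  -- The smaller team `Y` serves the `⊗` rules, whose subderivations are evaluated on one half of a
  -- split of `X`; the other hypotheses survive by downward closure.
  have sat_insert : ∀ {Γ : Set Formula} {ψ : Formula} {X Y : Team}, (∀ γ ∈ Γ, Sat X γ) → Y ⊆ X →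
      Sat Y ψ → ∀ γ ∈ insert ψ Γ, Sat Y γ := by
    rintro Γ ψ X Y hX hYX hψ γ (rfl | hγ)
    · exact hψ
    · exact (hX γ hγ).mono hYX
  induction h with
  | hyp h => exact fun X hX => hX _ h
  | em Γ i =>
    refine fun X _ => ⟨{s ∈ X | s i = true}, {s ∈ X | s i = false}, Set.sep_subset _ _,
      Set.sep_subset _ _, ?_, fun s hs => hs.2, fun s hs => hs.2⟩
    ext s
    cases hs : s i <;> simp [hs]
  | andI _ _ ih₁ ih₂ => exact fun X hX => ⟨ih₁ X hX, ih₂ X hX⟩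
  | andE₁ _ ih => exact fun X hX => (ih X hX).1
  | andE₂ _ ih => exact fun X hX => (ih X hX).2
  | veeI₁ _ ih => exact fun X hX => Or.inl (ih X hX)
  | veeI₂ _ ih => exact fun X hX => Or.inr (ih X hX)
  | veeE _ _ _ ih ih₁ ih₂ =>
    exact fun X hX => (ih X hX).elim (fun h => ih₁ X (sat_insert hX subset_rfl h))
      (fun h => ih₂ X (sat_insert hX subset_rfl h))
  | tensorI₁ _ ih =>
    exact fun X hX => ⟨X, ∅, subset_rfl, Set.empty_subset _, (Set.union_empty X).symm, ih X hX,
      sat_empty _⟩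
  | tensorI₂ _ ih =>
    exact fun X hX => ⟨∅, X, Set.empty_subset _, subset_rfl, (Set.empty_union X).symm, sat_empty _,
      ih X hX⟩
  | tensorE hα _ _ _ ih ih₁ ih₂ =>
    intro X hX
    obtain ⟨U, V, hU, hV, hUV, hφ, hψ⟩ := ih X hX
    -- Flatness is what allows truth of the classical conclusion on both halves to be glued into
    -- truth on `X`.
    have h₁ := hα.sat_iff.1 (ih₁ U (sat_insert hX hU hφ))
    have h₂ := hα.sat_iff.1 (ih₂ V (sat_insert hX hV hψ))
    refine hα.sat_iff.2 fun s hs => ?_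
    rw [hUV] at hs
    exact hs.elim (h₁ s) (h₂ s)
  | tensorSub _ _ ih ih' =>
    intro X hX
    obtain ⟨U, V, hU, hV, hUV, hφ, hψ⟩ := ih X hX
    exact ⟨U, V, hU, hV, hUV, hφ, ih' V (sat_insert hX hV hψ)⟩
  | tensorComm _ ih =>
    intro X hX
    obtain ⟨U, V, hU, hV, hUV, hφ, hψ⟩ := ih X hX
    exact ⟨V, U, hV, hU, hUV.trans (Set.union_comm U V), hψ, hφ⟩
  | tensorAssoc _ ih =>
    intro X hX
    obtain ⟨U, V, hU, hV, hUV, hφ, W, T, hW, hT, hWT, hψ, hχ⟩ := ih X hX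
    exact ⟨U ∪ W, T, Set.union_subset hU (hW.trans hV), hT.trans hV,
      by rw [hUV, hWT, Set.union_assoc], ⟨U, W, Set.subset_union_left, Set.subset_union_right, rfl,
      hφ, hψ⟩, hχ⟩
  | @botI Γ i _ ih =>
    intro X hX
    obtain ⟨h₁, h₂⟩ := ih X hX
    refine Set.eq_empty_of_forall_notMem fun s hs => ?_
    have h := h₁ s hs
    rw [h₂ s hs] at h
    exact Bool.false_ne_true h
  | botE _ ih =>
    intro X hX
    obtain ⟨U, V, -, -, hUV, hφ, hV⟩ := ih X hX
    have hV' : V = ∅ := hV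
    rwa [hUV, hV', Set.union_empty]
  | distr _ ih =>
    intro X hX
    obtain ⟨U, V, hU, hV, hUV, hφ, hψ⟩ := ih X hX
    exact hψ.imp (fun h => ⟨U, V, hU, hV, hUV, hφ, h⟩) (fun h => ⟨U, V, hU, hV, hUV, hφ, h⟩)

/-! ### Structural properties of derivations -/

theorem Derives.weaken {Γ Δ : Set Formula} {φ : Formula} (h : Derives Γ φ) (hΓ : Γ ⊆ Δ) :
    Derives Δ φ := by
  induction h generalizing Δ with
  | hyp h => exact .hyp (hΓ h)
  | em Γ i => exact .em Δ i
  | andI _ _ ih₁ ih₂ => exact .andI (ih₁ hΓ) (ih₂ hΓ)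
  | andE₁ _ ih => exact .andE₁ (ih hΓ)
  | andE₂ _ ih => exact .andE₂ (ih hΓ)
  | veeI₁ _ ih => exact .veeI₁ (ih hΓ)
  | veeI₂ _ ih => exact .veeI₂ (ih hΓ)
  | veeE _ _ _ ih ih₁ ih₂ =>
    exact .veeE (ih hΓ) (ih₁ (Set.insert_subset_insert hΓ)) (ih₂ (Set.insert_subset_insert hΓ))
  | tensorI₁ _ ih => exact .tensorI₁ (ih hΓ)
  | tensorI₂ _ ih => exact .tensorI₂ (ih hΓ)
  | tensorE hα _ _ _ ih ih₁ ih₂ =>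
    exact .tensorE hα (ih hΓ) (ih₁ (Set.insert_subset_insert hΓ))
      (ih₂ (Set.insert_subset_insert hΓ))
  | tensorSub _ _ ih ih' => exact .tensorSub (ih hΓ) (ih' (Set.insert_subset_insert hΓ))
  | tensorComm _ ih => exact .tensorComm (ih hΓ)
  | tensorAssoc _ ih => exact .tensorAssoc (ih hΓ)
  | botI _ ih => exact .botI (ih hΓ)
  | botE _ ih => exact .botE (ih hΓ)
  | distr _ ih => exact .distr (ih hΓ)

/-- There is no implication to pass through, so the hypothesis is discharged by eliminating `φ ∨ φ`.
-/
theorem Derives.cut {Γ : Set Formula} {φ ψ : Formula} (h : Derives Γ φ)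
    (h' : Derives (insert φ Γ) ψ) : Derives Γ ψ :=
  .veeE (.veeI₁ (ψ := φ) h) h' h'

theorem Derives.exFalso {Γ : Set Formula} {φ : Formula} (h : Derives Γ .bot) : Derives Γ φ :=
  .botE (.tensorI₂ h)

/-- Derivations use only finitely many hypotheses. -/
theorem Derives.exists_finite {Γ : Set Formula} {φ : Formula} (h : Derives Γ φ) :
    ∃ S ⊆ Γ, S.Finite ∧ Derives S φ := by
  -- The discharged hypothesis is removed from the finite set, so that what remains lies in `Γ`.
  have split : ∀ {Γ S : Set Formula} {ψ χ : Formula}, S ⊆ insert ψ Γ → S.Finite → Derives S χ →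
      ∃ T ⊆ Γ, T.Finite ∧ Derives (insert ψ T) χ := fun {Γ S ψ χ} hS hfin h =>
    ⟨S \ {ψ}, Set.sdiff_singleton_subset_iff.2 hS, hfin.sdiff,
      h.weaken (by rw [Set.insert_sdiff_singleton]; exact Set.subset_insert _ _)⟩
  induction h with
  | hyp h => exact ⟨{_}, Set.singleton_subset_iff.2 h, Set.finite_singleton _, .hyp rfl⟩
  | em Γ i => exact ⟨∅, Set.empty_subset _, Set.finite_empty, .em _ i⟩
  | andI _ _ ih₁ ih₂ =>
    obtain ⟨S, hS, hSf, h₁⟩ := ih₁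
    obtain ⟨T, hT, hTf, h₂⟩ := ih₂
    exact ⟨S ∪ T, Set.union_subset hS hT, hSf.union hTf,
      .andI (h₁.weaken Set.subset_union_left) (h₂.weaken Set.subset_union_right)⟩
  | andE₁ _ ih => obtain ⟨S, hS, hSf, h⟩ := ih; exact ⟨S, hS, hSf, .andE₁ h⟩
  | andE₂ _ ih => obtain ⟨S, hS, hSf, h⟩ := ih; exact ⟨S, hS, hSf, .andE₂ h⟩
  | veeI₁ _ ih => obtain ⟨S, hS, hSf, h⟩ := ih; exact ⟨S, hS, hSf, .veeI₁ h⟩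
  | veeI₂ _ ih => obtain ⟨S, hS, hSf, h⟩ := ih; exact ⟨S, hS, hSf, .veeI₂ h⟩
  | veeE _ _ _ ih ih₁ ih₂ =>
    obtain ⟨S, hS, hSf, h⟩ := ih
    obtain ⟨T, hT, hTf, h₁⟩ := ih₁
    obtain ⟨U, hU, hUf, h₂⟩ := ih₂
    obtain ⟨T, hT, hTf, h₁⟩ := split hT hTf h₁
    obtain ⟨U, hU, hUf, h₂⟩ := split hU hUf h₂
    exact ⟨S ∪ (T ∪ U), Set.union_subset hS (Set.union_subset hT hU), hSf.union (hTf.union hUf),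
      .veeE (h.weaken Set.subset_union_left)
        (h₁.weaken (Set.insert_subset_insert fun x hx => Or.inr (Or.inl hx)))
        (h₂.weaken (Set.insert_subset_insert fun x hx => Or.inr (Or.inr hx)))⟩
  | tensorI₁ _ ih => obtain ⟨S, hS, hSf, h⟩ := ih; exact ⟨S, hS, hSf, .tensorI₁ h⟩
  | tensorI₂ _ ih => obtain ⟨S, hS, hSf, h⟩ := ih; exact ⟨S, hS, hSf, .tensorI₂ h⟩
  | tensorE hα _ _ _ ih ih₁ ih₂ =>
    obtain ⟨S, hS, hSf, h⟩ := ih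
    obtain ⟨T, hT, hTf, h₁⟩ := ih₁
    obtain ⟨U, hU, hUf, h₂⟩ := ih₂
    obtain ⟨T, hT, hTf, h₁⟩ := split hT hTf h₁
    obtain ⟨U, hU, hUf, h₂⟩ := split hU hUf h₂
    exact ⟨S ∪ (T ∪ U), Set.union_subset hS (Set.union_subset hT hU), hSf.union (hTf.union hUf),
      .tensorE hα (h.weaken Set.subset_union_left)
        (h₁.weaken (Set.insert_subset_insert fun x hx => Or.inr (Or.inl hx)))
        (h₂.weaken (Set.insert_subset_insert fun x hx => Or.inr (Or.inr hx)))⟩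
  | tensorSub _ _ ih ih' =>
    obtain ⟨S, hS, hSf, h⟩ := ih
    obtain ⟨T, hT, hTf, h'⟩ := ih'
    obtain ⟨T, hT, hTf, h'⟩ := split hT hTf h'
    exact ⟨S ∪ T, Set.union_subset hS hT, hSf.union hTf,
      .tensorSub (h.weaken Set.subset_union_left)
        (h'.weaken (Set.insert_subset_insert Set.subset_union_right))⟩
  | tensorComm _ ih => obtain ⟨S, hS, hSf, h⟩ := ih; exact ⟨S, hS, hSf, .tensorComm h⟩
  | tensorAssoc _ ih => obtain ⟨S, hS, hSf, h⟩ := ih; exact ⟨S, hS, hSf, .tensorAssoc h⟩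
  | botI _ ih => obtain ⟨S, hS, hSf, h⟩ := ih; exact ⟨S, hS, hSf, .botI h⟩
  | botE _ ih => obtain ⟨S, hS, hSf, h⟩ := ih; exact ⟨S, hS, hSf, .botE h⟩
  | distr _ ih => obtain ⟨S, hS, hSf, h⟩ := ih; exact ⟨S, hS, hSf, .distr h⟩

/-! ### Maximal theories -/

/-- `Δ` is maximal among the sets of formulas that do not derive `φ`. -/
structure MaximalAvoiding (φ : Formula) (Δ : Set Formula) : Prop where
  not_derives : ¬ Derives Δ φ
  derives_of_notMem : ∀ ψ, ψ ∉ Δ → Derives (insert ψ Δ) φ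

/-- Lindenbaum's lemma. -/
theorem exists_maximalAvoiding {Γ : Set Formula} {φ : Formula} (h : ¬ Derives Γ φ) :
    ∃ Δ, Γ ⊆ Δ ∧ MaximalAvoiding φ Δ := by
  obtain ⟨Δ, hΓΔ, hΔ⟩ := zorn_subset_nonempty {Δ | ¬ Derives Δ φ} (fun c hc hchain hne => by
    refine ⟨⋃₀ c, fun hd => ?_, fun s hs => Set.subset_sUnion_of_mem hs⟩
    obtain ⟨S, hS, hSf, hd⟩ := hd.exists_finite
    -- The finitely many hypotheses used already lie in one member of the chain.
    obtain ⟨t, ht, hSt⟩ := hchain.directedOn.exists_mem_subset_of_finite_of_subset_sUnion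
      hne hSf hS
    exact hc ht (hd.weaken hSt)) Γ h
  refine ⟨Δ, hΓΔ, hΔ.prop, fun ψ hψ => ?_⟩
  by_contra hd
  exact hψ (hΔ.le_of_ge hd (Set.subset_insert _ _) (Set.mem_insert _ _))

namespace MaximalAvoiding

variable {φ : Formula} {Δ : Set Formula}

theorem mem_of_derives (hΔ : MaximalAvoiding φ Δ) {ψ : Formula} (h : Derives Δ ψ) : ψ ∈ Δ := by
  by_contra hψ
  exact hΔ.not_derives (h.cut (hΔ.derives_of_notMem ψ hψ))

theorem vee_mem (hΔ : MaximalAvoiding φ Δ) {ψ χ : Formula} (h : .vee ψ χ ∈ Δ) :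
    ψ ∈ Δ ∨ χ ∈ Δ := by
  by_contra! hn
  exact hΔ.not_derives
    (.veeE (.hyp h) (hΔ.derives_of_notMem ψ hn.1) (hΔ.derives_of_notMem χ hn.2))

/-- The avoided formula is the conclusion of the elimination, so it has to be classical. -/
theorem tensor_mem (hΔ : MaximalAvoiding φ Δ) (hφ : φ.IsClassical) {ψ χ : Formula}
    (h : .tensor ψ χ ∈ Δ) : ψ ∈ Δ ∨ χ ∈ Δ := by
  by_contra! hn
  exact hΔ.not_derives
    (.tensorE hφ (.hyp h) (hΔ.derives_of_notMem ψ hn.1) (hΔ.derives_of_notMem χ hn.2))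

theorem bot_notMem (hΔ : MaximalAvoiding φ Δ) : .bot ∉ Δ :=
  fun h => hΔ.not_derives (Derives.exFalso (.hyp h))

/-- A maximal theory avoiding a classical formula is, on classical formulas, the theory of a
single valuation. -/
theorem exists_valuation (hΔ : MaximalAvoiding φ Δ) (hφ : φ.IsClassical) :
    ∃ s : Valuation, ∀ α : Formula, α.IsClassical → (Sat {s} α ↔ α ∈ Δ) := by
  classical
  refine ⟨fun i => decide (.var i ∈ Δ), fun α hα => ?_⟩
  have var_or (i : ℕ) := hΔ.tensor_mem hφ (hΔ.mem_of_derives (.em Δ i))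
  have not_both (i : ℕ) (h : .var i ∈ Δ) (h' : .negVar i ∈ Δ) : False :=
    hΔ.bot_notMem (hΔ.mem_of_derives (.botI (.andI (.hyp h) (.hyp h'))))
  induction α with
  | var i => simp [Sat]
  | negVar i =>
    simp only [Sat, Set.mem_singleton_iff, forall_eq, decide_eq_false_iff_not]
    exact ⟨(var_or i).resolve_left, fun h' h => not_both i h h'⟩
  | bot => exact iff_of_false (Set.singleton_ne_empty _) hΔ.bot_notMem
  | and φ ψ ihφ ihψ =>
    simp only [Sat, ihφ hα.1, ihψ hα.2]
    exact ⟨fun h => hΔ.mem_of_derives (.andI (.hyp h.1) (.hyp h.2)),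
      fun h => ⟨hΔ.mem_of_derives (.andE₁ (.hyp h)), hΔ.mem_of_derives (.andE₂ (.hyp h))⟩⟩
  | tensor φ ψ ihφ ihψ =>
    refine (sat_singleton_tensor.trans (or_congr (ihφ hα.1) (ihψ hα.2))).trans ?_
    refine ⟨fun h => hΔ.mem_of_derives ?_, hΔ.tensor_mem hφ⟩
    exact h.elim (fun h => .tensorI₁ (.hyp h)) (fun h => .tensorI₂ (.hyp h))
  | vee φ ψ => exact hα.elim

end MaximalAvoiding

/-- Strong completeness of the classical fragment, with arbitrary extra hypotheses. -/
theorem derives_of_isClassical {Γ : Set Formula} {α : Formula} (hα : α.IsClassical)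
    (h : ∀ s : Valuation, (∀ β ∈ Γ, β.IsClassical → Sat {s} β) → Sat {s} α) : Derives Γ α := by
  by_contra hn
  obtain ⟨Δ, hΓΔ, hΔ⟩ := exists_maximalAvoiding hn
  obtain ⟨s, hs⟩ := hΔ.exists_valuation hα
  exact hΔ.not_derives (.hyp ((hs α hα).1 (h s fun β hβ hc => (hs β hc).2 (hΓΔ hβ))))

/-! ### Disjunctive normal form -/

/-- `φ` derives `ψ` in every context. -/
def Le (φ ψ : Formula) : Prop := ∀ Γ : Set Formula, Derives Γ φ → Derives Γ ψ

namespace Le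

variable {φ ψ χ φ' ψ' : Formula}

theorem trans (h : Le φ ψ) (h' : Le ψ χ) : Le φ χ := fun Γ hd => h' Γ (h Γ hd)

theorem veeElim (h : Le φ χ) (h' : Le ψ χ) : Le (.vee φ ψ) χ := fun _ hd =>
  .veeE hd (h _ (.hyp (Set.mem_insert _ _))) (h' _ (.hyp (Set.mem_insert _ _)))

theorem vee (h : Le φ φ') (h' : Le ψ ψ') : Le (.vee φ ψ) (.vee φ' ψ') :=
  veeElim (fun _ hd => .veeI₁ (h _ hd)) (fun _ hd => .veeI₂ (h' _ hd))

theorem and (h : Le φ φ') (h' : Le ψ ψ') : Le (.and φ ψ) (.and φ' ψ') := fun _ hd =>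
  .andI (h _ (.andE₁ hd)) (h' _ (.andE₂ hd))

/-- The substitution rule acts on the right disjunct only; commuting before and after a second use
reaches the left one. -/
theorem tensor (h : Le φ φ') (h' : Le ψ ψ') : Le (.tensor φ ψ) (.tensor φ' ψ') := fun _ hd =>
  .tensorComm (.tensorSub (.tensorComm (.tensorSub hd (h' _ (.hyp (Set.mem_insert _ _)))))
    (h _ (.hyp (Set.mem_insert _ _))))

theorem andComm (φ ψ : Formula) : Le (.and φ ψ) (.and ψ φ) := fun _ hd =>
  .andI (.andE₂ hd) (.andE₁ hd)

theorem tensorComm (φ ψ : Formula) : Le (.tensor φ ψ) (.tensor ψ φ) := fun _ hd =>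
  .tensorComm hd

theorem refl (φ : Formula) : Le φ φ := fun _ hd => hd

theorem veeInl (φ ψ : Formula) : Le φ (.vee φ ψ) := fun _ hd => .veeI₁ hd

theorem veeInr (φ ψ : Formula) : Le ψ (.vee φ ψ) := fun _ hd => .veeI₂ hd

theorem sat (h : Le φ ψ) {X : Team} (hX : Sat X φ) : Sat X ψ :=
  (h {φ} (.hyp rfl)).sound X (by rintro _ rfl; exact hX)

end Le

/-- Interderivability. -/
def Equi (φ ψ : Formula) : Prop := Le φ ψ ∧ Le ψ φ

namespace Equi

variable {φ ψ χ φ' ψ' : Formula}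

theorem refl (φ : Formula) : Equi φ φ := ⟨Le.refl φ, Le.refl φ⟩

theorem trans (h : Equi φ ψ) (h' : Equi ψ χ) : Equi φ χ := ⟨h.1.trans h'.1, h'.2.trans h.2⟩

theorem vee (h : Equi φ φ') (h' : Equi ψ ψ') : Equi (.vee φ ψ) (.vee φ' ψ') :=
  ⟨h.1.vee h'.1, h.2.vee h'.2⟩

theorem and (h : Equi φ φ') (h' : Equi ψ ψ') : Equi (.and φ ψ) (.and φ' ψ') :=
  ⟨h.1.and h'.1, h.2.and h'.2⟩

theorem tensor (h : Equi φ φ') (h' : Equi ψ ψ') : Equi (.tensor φ ψ) (.tensor φ' ψ') :=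
  ⟨h.1.tensor h'.1, h.2.tensor h'.2⟩

theorem andComm (φ ψ : Formula) : Equi (.and φ ψ) (.and ψ φ) :=
  ⟨Le.andComm φ ψ, Le.andComm ψ φ⟩

theorem tensorComm (φ ψ : Formula) : Equi (.tensor φ ψ) (.tensor ψ φ) :=
  ⟨Le.tensorComm φ ψ, Le.tensorComm ψ φ⟩

theorem andVee (φ ψ χ : Formula) :
    Equi (.and φ (.vee ψ χ)) (.vee (.and φ ψ) (.and φ χ)) := by
  refine ⟨fun Γ hd => .veeE (.andE₂ hd) (.veeI₁ (.andI ?_ (.hyp (Set.mem_insert _ _))))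
    (.veeI₂ (.andI ?_ (.hyp (Set.mem_insert _ _)))),
    .veeElim ((Le.refl φ).and (.veeInl ψ χ)) ((Le.refl φ).and (.veeInr ψ χ))⟩ <;>
  exact (Derives.andE₁ hd).weaken (Set.subset_insert _ _)

theorem tensorVee (φ ψ χ : Formula) :
    Equi (.tensor φ (.vee ψ χ)) (.vee (.tensor φ ψ) (.tensor φ χ)) :=
  ⟨fun _ hd => .distr hd,
    .veeElim ((Le.refl φ).tensor (.veeInl ψ χ)) ((Le.refl φ).tensor (.veeInr ψ χ))⟩

end Equi

/-- Intuitionistic disjunctions of classical formulas. -/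
inductive IsNormal : Formula → Prop where
  | classical {α : Formula} (hα : α.IsClassical) : IsNormal α
  | vee {φ ψ : Formula} : IsNormal φ → IsNormal ψ → IsNormal (.vee φ ψ)

/-- A commutative connective that preserves classicality and distributes over `∨` preserves, up to
interderivability, being normal. -/
theorem IsNormal.exists_equi {op : Formula → Formula → Formula}
    (classical : ∀ α β, α.IsClassical → β.IsClassical → (op α β).IsClassical)
    (comm : ∀ φ ψ, Equi (op φ ψ) (op ψ φ))
    (distrib : ∀ φ ψ χ, Equi (op φ (.vee ψ χ)) (.vee (op φ ψ) (op φ χ)))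
    {φ ψ : Formula} (hφ : IsNormal φ) (hψ : IsNormal ψ) :
    ∃ χ, IsNormal χ ∧ Equi (op φ ψ) χ := by
  -- Disjunctions are first distributed out of the right argument; once that is classical, `comm`
  -- brings the left one into position.
  induction hψ generalizing φ with
  | vee _ _ ih₁ ih₂ =>
    obtain ⟨χ₁, h₁, e₁⟩ := ih₁ hφ
    obtain ⟨χ₂, h₂, e₂⟩ := ih₂ hφ
    exact ⟨.vee χ₁ χ₂, h₁.vee h₂, (distrib _ _ _).trans (e₁.vee e₂)⟩
  | classical hβ =>
    induction hφ with
    | classical hα => exact ⟨_, .classical (classical _ _ hα hβ), .refl _⟩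
    | vee _ _ ih₁ ih₂ =>
      obtain ⟨χ₁, h₁, e₁⟩ := ih₁
      obtain ⟨χ₂, h₂, e₂⟩ := ih₂
      exact ⟨.vee χ₁ χ₂, h₁.vee h₂, (comm _ _).trans ((distrib _ _ _).trans
        (((comm _ _).trans e₁).vee ((comm _ _).trans e₂)))⟩

theorem Formula.exists_isNormal (φ : Formula) : ∃ χ, IsNormal χ ∧ Equi φ χ := by
  induction φ with
  | var i => exact ⟨.var i, .classical trivial, .refl _⟩
  | negVar i => exact ⟨.negVar i, .classical trivial, .refl _⟩
  | bot => exact ⟨.bot, .classical trivial, .refl _⟩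
  | and φ ψ ihφ ihψ =>
    obtain ⟨φ', hφ, eφ⟩ := ihφ
    obtain ⟨ψ', hψ, eψ⟩ := ihψ
    obtain ⟨χ, hχ, e⟩ := IsNormal.exists_equi (op := .and) (fun _ _ h h' => ⟨h, h'⟩)
      Equi.andComm Equi.andVee hφ hψ
    exact ⟨χ, hχ, (eφ.and eψ).trans e⟩
  | tensor φ ψ ihφ ihψ =>
    obtain ⟨φ', hφ, eφ⟩ := ihφ
    obtain ⟨ψ', hψ, eψ⟩ := ihψ
    obtain ⟨χ, hχ, e⟩ := IsNormal.exists_equi (op := .tensor) (fun _ _ h h' => ⟨h, h'⟩)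
      Equi.tensorComm Equi.tensorVee hφ hψ
    exact ⟨χ, hχ, (eφ.tensor eψ).trans e⟩
  | vee φ ψ ihφ ihψ =>
    obtain ⟨φ', hφ, eφ⟩ := ihφ
    obtain ⟨ψ', hψ, eψ⟩ := ihψ
    exact ⟨_, hφ.vee hψ, eφ.vee eψ⟩

/-! ### The canonical team -/

/-- The team of all valuations satisfying the classical members of `Δ`. -/
def canonicalTeam (Δ : Set Formula) : Team :=
  {s | ∀ β ∈ Δ, β.IsClassical → Sat {s} β}

theorem MaximalAvoiding.sat_canonicalTeam_iff {φ : Formula} {Δ : Set Formula}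
    (hΔ : MaximalAvoiding φ Δ) (ψ : Formula) : Sat (canonicalTeam Δ) ψ ↔ ψ ∈ Δ := by
  obtain ⟨χ, hχ, h₁, h₂⟩ := ψ.exists_isNormal
  suffices h : Sat (canonicalTeam Δ) χ ↔ χ ∈ Δ from
    ⟨fun hs => hΔ.mem_of_derives (h₂ Δ (.hyp (h.1 (h₁.sat hs)))),
      fun hm => h₂.sat (h.2 (hΔ.mem_of_derives (h₁ Δ (.hyp hm))))⟩
  clear h₁ h₂
  induction hχ with
  | classical hα =>
    exact ⟨fun h => hΔ.mem_of_derives (derives_of_isClassical hα (hα.sat_iff.1 h)),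
      fun h => hα.sat_iff.2 fun s hs => hs _ h hα⟩
  | vee _ _ ih₁ ih₂ =>
    refine (or_congr ih₁ ih₂).trans ⟨fun h => ?_, hΔ.vee_mem⟩
    exact hΔ.mem_of_derives (h.elim (fun h => .veeI₁ (.hyp h)) (fun h => .veeI₂ (.hyp h)))

end PDVee

theorem theorem4p10 (Γ : Set PDVee.Formula) (φ : PDVee.Formula)
    (h : PDVee.Entails Γ φ) : PDVee.Derives Γ φ := by
  by_contra hn
  obtain ⟨Δ, hΓΔ, hΔ⟩ := PDVee.exists_maximalAvoiding hn
  exact hΔ.not_derives (.hyp ((hΔ.sat_canonicalTeam_iff φ).1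
    (h _ fun γ hγ => (hΔ.sat_canonicalTeam_iff γ).2 (hΓΔ hγ))))
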